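/- Let $\mathcal L_{HA}=\{0,1,\sqcap,\sqcup,\to\}$ be the first-order language of Heyting algebras, let $n\geq 1$, and let $F_n$ be the free Heyting algebra over $n$ generators $g_1,\dots,g_n$. The generic Kripke model $K_n=\bigcup_{d} K_n^d$ is defined as follows. Put $K_n^{-1}=\emptyset$. For $d\ge 0$, the set $K_n^d\setminus K_n^{d-1}$ consists of all formal points $w_{\beta,Y}$ such that (i) $Y$ is a decreasing subset of $K_n^{d-1}$, with $Y\not\subseteq K_n^{d-2}$ if $d\geq 1$; (ii) $\beta\subseteq\{P_1,\dots,P_n\}$ and $\beta\subseteq\beta'$ for all $w_{\beta',Y'}\in Y$; (iii) if $Y$ is the decreasing set generated by a single point $w_{\beta',Y'}$, then $\beta\neq\beta'$. The order is given by $w\le w_{\beta,Y}$ iff $w\in Y$ or $w=w_{\beta,Y}$. Let $\widehat F_n$ be the Heyting algebra of all decreasing subsets of $K_n$, with the metric $d(a,b)=2^{-\min\{i\ \mid\ a\cap K_n^i\neq b\cap K_n^i\}}$ (where $2^{-\min\emptyset}=0$). The algebra $F_n$ is mapped to $\widehat F_n$ by the homomorphism that sends $g_i$ to $\{w_{\beta,Y}\in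 K_n\mid P_i\in\beta\}$ (by a theorem of Bellissima this is an embedding), and $F_n$ carries the topology induced by this map. Then: (a) $F_n$ is an algebraic prime model of its first-order theory: every $\mathcal L_{HA}$-structure $M$ that is a model of the complete first-order theory of $F_n$ admits an embedding $F_n\hookrightarrow M$ of $\mathcal L_{HA}$-structures. (b) If $H$ is a proper Heyting sub-algebra of $F_n$ that is dense in $F_n$, then $H$ is not elementarily equivalent to $F_n$ in the language $\mathcal L_{HA}$. -/

import Mathlib

open scoped FirstOrder

namespace FreeHA

/-! ### The first-order language of Heyting algebras -/

/-- Function symbols: constants `0`, `1`, and binary `⊓`, `⊔`, `→`. -/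
inductive HAFunc : ℕ → Type
  | zero : HAFunc 0
  | one : HAFunc 0
  | inf : HAFunc 2
  | sup : HAFunc 2
  | imp : HAFunc 2

/-- The language `{0, 1, ⊓, ⊔, →}`. -/
def LHA : FirstOrder.Language.{0, 0} where
  Functions := HAFunc
  Relations := fun _ => Empty

/-- Every Heyting algebra is a structure for the language of Heyting algebras. -/
instance haStructure (H : Type*) [HeytingAlgebra H] : LHA.Structure H where
  funMap := fun {k} (f : HAFunc k) =>
    match k, f with
    | _, HAFunc.zero => fun _ => ⊥
    | _, HAFunc.one => fun _ => ⊤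
    | _, HAFunc.inf => fun x => x 0 ⊓ x 1
    | _, HAFunc.sup => fun x => x 0 ⊔ x 1
    | _, HAFunc.imp => fun x => x 0 ⇨ x 1
  RelMap := fun r _ => nomatch r

/-! ### Free Heyting algebras -/

/-- Heyting terms in the variables `α`. -/
inductive HTerm (α : Type*)
  | var : α → HTerm α
  | bot : HTerm α
  | top : HTerm α
  | inf : HTerm α → HTerm α → HTerm α
  | sup : HTerm α → HTerm α → HTerm α
  | imp : HTerm α → HTerm α → HTerm α

/-- The least preorder on terms that satisfies the laws of Heyting algebras
(entailment of intuitionistic propositional logic). -/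
inductive HTerm.Le {α : Type*} : HTerm α → HTerm α → Prop
  | refl (a) : Le a a
  | trans {a b c} : Le a b → Le b c → Le a c
  | bot_le (a) : Le .bot a
  | le_top (a) : Le a .top
  | inf_left (a b) : Le (.inf a b) a
  | inf_right (a b) : Le (.inf a b) b
  | le_inf {a b c} : Le a b → Le a c → Le a (.inf b c)
  | left_sup (a b) : Le a (.sup a b)
  | right_sup (a b) : Le b (.sup a b)
  | sup_le {a b c} : Le a c → Le b c → Le (.sup a b) c
  | imp_intro {a b c} : Le (.inf a b) c → Le a (.imp b c)
  | imp_elim {a b c} : Le a (.imp b c) → Le (.inf a b) c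

/-- Two terms are identified when each entails the other. -/
def HTerm.setoid (α : Type*) : Setoid (HTerm α) where
  r a b := HTerm.Le a b ∧ HTerm.Le b a
  iseqv :=
    { refl := fun a => ⟨.refl a, .refl a⟩
      symm := fun h => ⟨h.2, h.1⟩
      trans := fun h k => ⟨h.1.trans k.1, k.2.trans h.2⟩ }

/-- The free Heyting algebra over the set `α` of generators. -/
def FreeHeyting (α : Type*) : Type _ := Quotient (HTerm.setoid α)

namespace FreeHeyting

variable {α : Type*}

/-- The class of a term. -/
def mk (t : HTerm α) : FreeHeyting α := Quotient.mk (HTerm.setoid α) t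

/-- The free generators. -/
def gen (i : α) : FreeHeyting α := mk (.var i)

instance : HeytingAlgebra (FreeHeyting α) where
  le := Quotient.lift₂ HTerm.Le (by
    rintro a b a' b' ⟨h1, h2⟩ ⟨h3, h4⟩
    exact propext ⟨fun h => h2.trans (h.trans h3), fun h => h1.trans (h.trans h4)⟩)
  le_refl := by rintro ⟨a⟩; exact .refl a
  le_trans := by rintro ⟨a⟩ ⟨b⟩ ⟨c⟩ h k; exact HTerm.Le.trans h k
  le_antisymm := by rintro ⟨a⟩ ⟨b⟩ h k; exact Quotient.sound ⟨h, k⟩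
  sup := Quotient.map₂ .sup (by
    rintro a a' ⟨h1, h2⟩ b b' ⟨h3, h4⟩
    exact ⟨.sup_le (h1.trans (.left_sup _ _)) (h3.trans (.right_sup _ _)),
      .sup_le (h2.trans (.left_sup _ _)) (h4.trans (.right_sup _ _))⟩)
  le_sup_left := by rintro ⟨a⟩ ⟨b⟩; exact .left_sup a b
  le_sup_right := by rintro ⟨a⟩ ⟨b⟩; exact .right_sup a b
  sup_le := by rintro ⟨a⟩ ⟨b⟩ ⟨c⟩ h k; exact HTerm.Le.sup_le h k
  inf := Quotient.map₂ .inf (by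
    rintro a a' ⟨h1, h2⟩ b b' ⟨h3, h4⟩
    exact ⟨.le_inf (.trans (.inf_left _ _) h1) (.trans (.inf_right _ _) h3),
      .le_inf (.trans (.inf_left _ _) h2) (.trans (.inf_right _ _) h4)⟩)
  inf_le_left := by rintro ⟨a⟩ ⟨b⟩; exact .inf_left a b
  inf_le_right := by rintro ⟨a⟩ ⟨b⟩; exact .inf_right a b
  le_inf := by rintro ⟨a⟩ ⟨b⟩ ⟨c⟩ h k; exact HTerm.Le.le_inf h k
  top := mk .top
  le_top := by rintro ⟨a⟩; exact .le_top a
  bot := mk .bot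
  bot_le := by rintro ⟨a⟩; exact .bot_le a
  himp := Quotient.map₂ .imp (by
    have key : ∀ {a a' b b' : HTerm α}, a'.Le a → b.Le b' →
        (HTerm.imp a b).Le (.imp a' b') := fun h k =>
      .imp_intro (.trans (.le_inf (.inf_left _ _) (.trans (.inf_right _ _) h))
        (.trans (.imp_elim (.refl _)) k))
    rintro a a' ⟨h1, h2⟩ b b' ⟨h3, h4⟩
    exact ⟨key h2 h3, key h1 h4⟩)
  le_himp_iff := by
    rintro ⟨a⟩ ⟨b⟩ ⟨c⟩
    exact ⟨fun h => HTerm.Le.imp_elim h, fun h => HTerm.Le.imp_intro h⟩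
  compl := Quotient.map (fun a => .imp a .bot) (by
    rintro a a' ⟨h1, h2⟩
    exact ⟨.imp_intro (.trans (.le_inf (.inf_left _ _) (.trans (.inf_right _ _) h2))
        (.imp_elim (.refl _))),
      .imp_intro (.trans (.le_inf (.inf_left _ _) (.trans (.inf_right _ _) h1))
        (.imp_elim (.refl _)))⟩)
  himp_bot := by rintro ⟨a⟩; rfl

/-- The value of a term in a Heyting algebra. -/
def value {H : Type*} [HeytingAlgebra H] (f : α → H) : HTerm α → H
  | .var i => f i
  | .bot => ⊥
  | .top => ⊤
  | .inf a b => value f a ⊓ value f b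
  | .sup a b => value f a ⊔ value f b
  | .imp a b => value f a ⇨ value f b

theorem value_mono {H : Type*} [HeytingAlgebra H] (f : α → H) {a b : HTerm α}
    (h : a.Le b) : value f a ≤ value f b := by
  induction h with
  | refl => exact le_rfl
  | trans _ _ h k => exact h.trans k
  | bot_le => exact bot_le
  | le_top => exact le_top
  | inf_left => exact inf_le_left
  | inf_right => exact inf_le_right
  | le_inf _ _ h k => exact le_inf h k
  | left_sup => exact le_sup_left
  | right_sup => exact le_sup_right
  | sup_le _ _ h k => exact sup_le h k
  | imp_intro _ h => exact le_himp_iff.2 h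
  | imp_elim _ h => exact le_himp_iff.1 h

/-- The homomorphism that extends a map on the generators. -/
def lift {H : Type*} [HeytingAlgebra H] (f : α → H) : HeytingHom (FreeHeyting α) H where
  toFun := Quotient.lift (value f)
    fun _ _ h => le_antisymm (value_mono f h.1) (value_mono f h.2)
  map_sup' := by rintro ⟨a⟩ ⟨b⟩; rfl
  map_inf' := by rintro ⟨a⟩ ⟨b⟩; rfl
  map_bot' := rfl
  map_himp' := by rintro ⟨a⟩ ⟨b⟩; rfl

@[simp] theorem lift_gen {H : Type*} [HeytingAlgebra H] (f : α → H) (i : α) :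
    lift f (gen i) = f i := rfl

/-- Uniqueness in the universal property. -/
theorem hom_ext {H : Type*} [HeytingAlgebra H] {φ ψ : HeytingHom (FreeHeyting α) H}
    (h : ∀ i, φ (gen i) = ψ (gen i)) : φ = ψ := by
  have key : ∀ t : HTerm α, φ (mk t) = ψ (mk t) := by
    intro t
    induction t with
    | var i => exact h i
    | bot => exact (map_bot φ).trans (map_bot ψ).symm
    | top => exact (map_top φ).trans (map_top ψ).symm
    | inf a b ha hb =>
      have e : mk (.inf a b) = mk a ⊓ mk b := rfl
      rw [e, map_inf, map_inf, ha, hb]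
    | sup a b ha hb =>
      have e : mk (.sup a b) = mk a ⊔ mk b := rfl
      rw [e, map_sup, map_sup, ha, hb]
    | imp a b ha hb =>
      have e : mk (.imp a b) = mk a ⇨ mk b := rfl
      rw [e, map_himp, map_himp, ha, hb]
  ext x
  obtain ⟨t⟩ := x
  exact key t

end FreeHeyting

/-- The free Heyting algebra over `n` generators. -/
abbrev Fr (n : ℕ) : Type := FreeHeyting (Fin n)

/-! ### The generic Kripke model

A point `w_{β,Y}` is a formal name of the pair `(β, Y)` of a set `β` of variables and a finite set
`Y` of points. As names we use natural numbers, through an injection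
`Finset (Fin n) × Finset ℕ → ℕ`. -/

/-- The name `w_{β,Y}`. -/
def pt {n : ℕ} (β : Finset (Fin n)) (Y : Finset ℕ) : ℕ := Encodable.encode (β, Y)

/-- The pair named by `m` (junk if `m` is not a name). -/
def unpt (n m : ℕ) : Finset (Fin n) × Finset ℕ :=
  (Encodable.decode (α := Finset (Fin n) × Finset ℕ) m).getD (∅, ∅)

@[simp] theorem unpt_pt {n : ℕ} (β : Finset (Fin n)) (Y : Finset ℕ) :
    unpt n (pt β Y) = (β, Y) := by simp [unpt, pt]

/-- The valuation `β` of `w_{β,Y}`. -/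
def ptVal (n m : ℕ) : Finset (Fin n) := (unpt n m).1

/-- The set `Y` of points strictly below `w_{β,Y}`. -/
def ptBelow (n m : ℕ) : Finset ℕ := (unpt n m).2

/-- `w ≤ w_{β,Y}` iff `w ∈ Y` or `w = w_{β,Y}`. -/
def ptLe (n u v : ℕ) : Prop := u ∈ ptBelow n v ∨ u = v

/-- For a stage `A` and a set `Y ⊆ A`, the conditions on `β` and `Y` for `w_{β,Y}` to be a point of
the next stage, apart from the condition on its rank. -/
structure Admissible (n : ℕ) (A : Set ℕ) (β : Finset (Fin n)) (Y : Finset ℕ) : Prop where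
  subset : (Y : Set ℕ) ⊆ A
  decreasing : ∀ v ∈ Y, ∀ u ∈ A, ptLe n u v → u ∈ Y
  val_mono : ∀ v ∈ Y, β ⊆ ptVal n v
  reduced : ∀ v ∈ A, (Y : Set ℕ) = {u ∈ A | ptLe n u v} → β ≠ ptVal n v

/-- `stage n d` is the set of points of rank less than `d`: the stage `K_n^{d-1}`, with
`K_n^{-1} = ∅`. All stages are finite, so all their subsets are given by a `Finset`. -/
def stage (n : ℕ) : ℕ → Set ℕ
  | 0 => ∅
  | 1 => {m | ∃ β : Finset (Fin n), m = pt β ∅}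
  | d + 2 => stage n (d + 1) ∪
      {m | ∃ (β : Finset (Fin n)) (Y : Finset ℕ), m = pt β Y ∧
        Admissible n (stage n (d + 1)) β Y ∧ ¬ (Y : Set ℕ) ⊆ stage n d}

theorem stage_mono_succ (n d : ℕ) : stage n d ⊆ stage n (d + 1) := by
  cases d with
  | zero => exact Set.empty_subset _
  | succ d => exact Set.subset_union_left

theorem stage_mono (n : ℕ) : Monotone (stage n) :=
  monotone_nat_of_le_succ (stage_mono_succ n)

theorem exists_of_mem_stage {n d m : ℕ} (hm : m ∈ stage n d) :
    ∃ e < d, (ptBelow n m : Set ℕ) ⊆ stage n e ∧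
      ∀ v ∈ ptBelow n m, ∀ u ∈ stage n e, ptLe n u v → u ∈ ptBelow n m ∧
        ptVal n m ⊆ ptVal n v := by
  induction d with
  | zero => exact hm.elim
  | succ d ih =>
    cases d with
    | zero =>
      obtain ⟨β, rfl⟩ := hm
      exact ⟨0, by simp, by simp [ptBelow], by simp [ptBelow]⟩
    | succ d =>
      rcases hm with hm | ⟨β, Y, rfl, hA, -⟩
      · obtain ⟨e, he, h⟩ := ih hm
        exact ⟨e, by omega, h⟩
      · refine ⟨d + 1, by omega, by simpa [ptBelow] using hA.subset, ?_⟩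
        simp only [ptBelow, ptVal, unpt_pt]
        exact fun v hv u hu huv => ⟨hA.decreasing v hv u hu huv, hA.val_mono v hv⟩

/-- The set of points of the generic Kripke model. -/
def K (n : ℕ) : Type := {m : ℕ // ∃ d, m ∈ stage n d}

theorem below_below {n d u v m : ℕ} (hm : m ∈ stage n d) (hv : v ∈ ptBelow n m)
    (hu : u ∈ ptBelow n v) : u ∈ ptBelow n m := by
  obtain ⟨e, -, h1, h2⟩ := exists_of_mem_stage hm
  obtain ⟨f, hf, h3, -⟩ := exists_of_mem_stage (h1 hv)
  exact (h2 v hv u (stage_mono n hf.le (h3 hu)) (Or.inl hu)).1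

theorem not_mem_below_self {n d : ℕ} : ∀ {m : ℕ}, m ∈ stage n d → m ∉ ptBelow n m := by
  induction d using Nat.strong_induction_on with
  | _ d ih =>
    intro m hm h
    obtain ⟨e, he, h1, -⟩ := exists_of_mem_stage hm
    exact ih e he (h1 h) h

instance (n : ℕ) : PartialOrder (K n) where
  le u v := ptLe n u.1 v.1
  le_refl u := Or.inr rfl
  le_trans := by
    rintro ⟨u, hu⟩ ⟨v, hv⟩ ⟨m, d, hm⟩ (h | rfl) (k | rfl)
    · exact Or.inl (below_below hm k h)
    · exact Or.inl h
    · exact Or.inl k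
    · exact Or.inr rfl
  le_antisymm := by
    rintro ⟨u, d, hu⟩ ⟨v, hv⟩ (h | rfl) (k | k)
    · exact (not_mem_below_self hu (below_below hu k h)).elim
    · exact Subtype.ext k.symm
    · rfl
    · rfl

/-- The valuation of the generic Kripke model. -/
def K.val {n : ℕ} (w : K n) : Finset (Fin n) := ptVal n w.1

theorem K.val_anti {n : ℕ} {u v : K n} (h : u ≤ v) : v.val ⊆ u.val := by
  obtain ⟨v, d, hv⟩ := v
  rcases h with h | h
  · obtain ⟨e, -, h1, h2⟩ := exists_of_mem_stage hv
    exact (h2 u.1 h u.1 (h1 h) (Or.inr rfl)).2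
  · have : u = ⟨v, d, hv⟩ := Subtype.ext h
    rw [this]

/-! ### The Heyting algebra of decreasing sets, its metric, and the metric on `Fr n` -/

/-- The Heyting algebra of all decreasing subsets of the generic Kripke model. -/
abbrev FrHat (n : ℕ) : Type := LowerSet (K n)

/-- `a ∩ K_n^i`. -/
def cut {n : ℕ} (i : ℕ) (a : FrHat n) : Set (K n) := {w | w ∈ a ∧ w.1 ∈ stage n (i + 1)}

theorem cut_ext {n : ℕ} {a b : FrHat n} (h : ∀ i, cut i a = cut i b) : a = b := by
  ext w
  obtain ⟨d, hd⟩ := w.2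
  have := Set.ext_iff.1 (h d) w
  simpa [cut, stage_mono_succ n d hd] using this

theorem cut_mono {n : ℕ} {i j : ℕ} (hij : i ≤ j) {a b : FrHat n} (h : cut j a = cut j b) :
    cut i a = cut i b := by
  ext w
  have := Set.ext_iff.1 h w
  simp only [cut, Set.mem_ofPred_eq] at this ⊢
  have hm : w.1 ∈ stage n (i + 1) → w.1 ∈ stage n (j + 1) :=
    fun hw => stage_mono n (by omega) hw
  tauto

open Classical in
/-- The distance `2 ^ (-min {i | a ∩ K_n^i ≠ b ∩ K_n^i})`, where `2 ^ (-min ∅) = 0`. -/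
noncomputable def hatDist {n : ℕ} (a b : FrHat n) : ℝ :=
  if h : ∃ i, cut i a ≠ cut i b then (2⁻¹ : ℝ) ^ Nat.find h else 0

theorem hatDist_le_iff {n : ℕ} (a b : FrHat n) (r : ℝ) (hr : 0 ≤ r) :
    hatDist a b ≤ r ↔ ∀ i, r < (2⁻¹ : ℝ) ^ i → cut i a = cut i b := by
  classical
  unfold hatDist
  split_ifs with h
  · constructor
    · intro hle i hi
      by_contra hne
      have h1 : Nat.find h ≤ i := Nat.find_min' h hne
      have h2 : (2⁻¹ : ℝ) ^ i ≤ (2⁻¹ : ℝ) ^ Nat.find h :=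
        pow_le_pow_of_le_one (by norm_num) (by norm_num) h1
      linarith
    · intro hall
      by_contra hlt
      exact Nat.find_spec h (hall _ (not_le.1 hlt))
  · push Not at h
    exact ⟨fun _ i _ => h i, fun _ => hr⟩

theorem hatDist_nonneg {n : ℕ} (a b : FrHat n) : 0 ≤ hatDist a b := by
  unfold hatDist
  split_ifs <;> positivity

noncomputable instance (n : ℕ) : MetricSpace (FrHat n) where
  dist := hatDist
  dist_self a := by simp [hatDist]
  dist_comm a b := by
    apply le_antisymm
    · exact (hatDist_le_iff a b _ (hatDist_nonneg _ _)).2 fun i hi =>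
        ((hatDist_le_iff b a _ (hatDist_nonneg _ _)).1 le_rfl i hi).symm
    · exact (hatDist_le_iff b a _ (hatDist_nonneg _ _)).2 fun i hi =>
        ((hatDist_le_iff a b _ (hatDist_nonneg _ _)).1 le_rfl i hi).symm
  dist_triangle a b c := by
    have h1 := hatDist_nonneg a b
    have h2 := hatDist_nonneg b c
    refine (hatDist_le_iff a c _ (by positivity)).2 fun i hi => ?_
    exact ((hatDist_le_iff a b _ h1).1 le_rfl i (by linarith)).trans
      ((hatDist_le_iff b c _ h2).1 le_rfl i (by linarith))
  eq_of_dist_eq_zero := by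
    intro a b h
    exact cut_ext fun i => (hatDist_le_iff a b 0 le_rfl).1 (le_of_eq h) i (by positivity)

/-- The set of points at which the variable `P_i` is valid. -/
def varSet {n : ℕ} (i : Fin n) : FrHat n where
  carrier := {w | i ∈ w.val}
  lower' := fun _ _ h hi => K.val_anti h hi

/-- The canonical homomorphism from the free Heyting algebra to the algebra of decreasing sets; it
sends the `i`-th generator to the set of points at which `P_i` is valid. -/
noncomputable def toHat (n : ℕ) : HeytingHom (Fr n) (FrHat n) := FreeHeyting.lift varSet

/-- The metric of `Fr n` is the one of its image in `FrHat n`. -/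
noncomputable instance (n : ℕ) : PseudoMetricSpace (Fr n) :=
  PseudoMetricSpace.induced (toHat n) inferInstance

end FreeHA

/-!
The free algebra `Fr n` is studied through its image in `FrHat n`, the decreasing sets of points of
the generic Kripke model. The point of the argument is that a single first-order formula defines the
set of generators, both in `Fr n` and in every dense subalgebra of it.

* `toHat` is injective (`toHat_injective`): every prime ideal of `Fr n` is matched, on a given finite
  set of terms, by a point of the generic model (`exists_point_of_isPrime`), because the generic
  model realizes every finite decreasing set `Y` together with every valuation contained in those of
  the points of `Y` (`K.exists_Iic_eq_insert`).
* The image of `toHat` contains the set generated by any point (`Iic_mem_range`), by means of the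
  de Jongh formulas (`Iic_eq_deJongh`). These sets are isolated (`eq_of_cut_eq`), so that every dense
  subalgebra contains them too (`mem_of_dense`).
* In an algebra of decreasing sets that contains all these sets, they are the elements with a
  greatest element strictly below them (`isGreatest_lt_iff`). The ordered set of points is thereby
  interpretable in the algebra, and it remains to recover the valuation from the order.
  Let `p` be the minimal point of valuation `{i}`. If `p` is not below `w`, the points strictly above
  exactly the points below `w` or `p` correspond to the subsets of `w.val ∩ {i}`, so that there are
  two of them iff `i` belongs to `w.val`, and one otherwise; the case `p ≤ w` is similar
  (`K.mem_val_iff`). These points `p` are themselves singled out among the minimal points: exactly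
  one point has `p` as the only point strictly below it (`K.existsUnique_cover_iff`). Since an
  element of the algebra is determined by the points it contains, this defines the set of generators
  (`realize_genF`).

Let `basisF n` be the formula saying of `n` elements that they are the generators in some order.
A model `M` of the theory of `Fr n` contains a solution of it; a permutation of the generators
extends to an automorphism, so that all solutions in `Fr n`, and then those in `M`, satisfy exactly
the identities that hold between the generators. This gives the embedding of `Fr n` into `M`.
If a dense subalgebra is elementarily equivalent to `Fr n`, it contains a solution too, whose
components are all the generators, and therefore it is `Fr n`.
-/

namespace FreeHA

/-! ### Points of the generic Kripke model -/

section Points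

variable {n : ℕ}

theorem pt_eta {d m : ℕ} (hm : m ∈ stage n d) : pt (ptVal n m) (ptBelow n m) = m := by
  induction d with
  | zero => exact hm.elim
  | succ d ih =>
    cases d with
    | zero => obtain ⟨β, rfl⟩ := hm; simp [ptVal, ptBelow]
    | succ d =>
      rcases hm with hm | ⟨β, Y, rfl, -⟩
      · exact ih hm
      · simp [ptVal, ptBelow]

theorem mem_stage_of_below {d m u : ℕ} (hm : m ∈ stage n d) (hu : u ∈ ptBelow n m) :
    u ∈ stage n d := by
  obtain ⟨e, he, h, -⟩ := exists_of_mem_stage hm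
  exact stage_mono n he.le (h hu)

theorem admissible_of_mem_stage {d m : ℕ} (hm : m ∈ stage n d) :
    ∃ e, Admissible n (stage n e) (ptVal n m) (ptBelow n m) := by
  induction d with
  | zero => exact hm.elim
  | succ d ih =>
    cases d with
    | zero =>
      obtain ⟨β, rfl⟩ := hm
      exact ⟨0, by simp [ptBelow], by simp [ptBelow], by simp [ptBelow], fun v hv => hv.elim⟩
    | succ d =>
      rcases hm with hm | ⟨β, Y, rfl, hA, -⟩
      · exact ih hm
      · exact ⟨d + 1, by simpa [ptVal, ptBelow] using hA⟩

namespace K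

/-- An element of a stage, as a point of the generic Kripke model. -/
def of {d m : ℕ} (h : m ∈ stage n d) : K n := ⟨m, d, h⟩

@[simp] theorem of_val {d m : ℕ} (h : m ∈ stage n d) : (of h).1 = m := rfl

theorem le_def {u v : K n} : u ≤ v ↔ ptLe n u.1 v.1 := Iff.rfl

theorem lt_iff {u v : K n} : u < v ↔ u.1 ∈ ptBelow n v.1 := by
  constructor
  · intro h
    rcases h.le with h' | h'
    · exact h'
    · exact (h.ne (Subtype.ext h')).elim
  · intro h
    refine lt_of_le_of_ne (Or.inl h) ?_
    rintro rfl
    obtain ⟨d, hd⟩ := u.2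
    exact not_mem_below_self hd h

/-- A point is determined by its valuation and the set of points strictly below it. -/
theorem eq_of_val_eq {u v : K n} (hval : u.val = v.val) (h : Set.Iio u = Set.Iio v) : u = v := by
  obtain ⟨d, hd⟩ := u.2
  obtain ⟨e, he⟩ := v.2
  apply Subtype.ext
  rw [← pt_eta hd, ← pt_eta he]
  have hb : ptBelow n u.1 = ptBelow n v.1 := by
    ext x
    constructor
    · intro hx
      exact lt_iff.1 ((Set.ext_iff.1 h (of (mem_stage_of_below hd hx))).1 (lt_iff.2 hx))
    · intro hx
      exact lt_iff.1 ((Set.ext_iff.1 h (of (mem_stage_of_below he hx))).2 (lt_iff.2 hx))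
  rw [hb, show ptVal n u.1 = ptVal n v.1 from hval]

theorem finite_Iio (w : K n) : (Set.Iio w).Finite := by
  refine Set.Finite.of_finite_image (f := fun x : K n => x.1) ?_
      Subtype.val_injective.injOn
  refine (ptBelow n w.1).finite_toSet.subset ?_
  rintro _ ⟨u, hu, rfl⟩
  exact lt_iff.1 hu

theorem finite_Iic (w : K n) : (Set.Iic w).Finite := by
  rw [← Set.Iio_insert]
  exact (finite_Iio w).insert w

instance : WellFoundedLT (K n) :=
  ⟨Subrelation.wf (r := InvImage (· < ·) fun w : K n => (Set.Iio w).ncard)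
    (fun {u v} h => Set.ncard_lt_ncard ⟨fun _ hx => lt_trans hx h, fun hs => lt_irrefl u (hs h)⟩
      (finite_Iio v)) (InvImage.wf _ wellFounded_lt)⟩

/-- A point covering a single point differs from it in valuation. -/
theorem val_ne_of_Iio_eq_Iic {w v : K n} (h : Set.Iio w = Set.Iic v) : w.val ≠ v.val := by
  obtain ⟨d, hd⟩ := w.2
  obtain ⟨e, hA⟩ := admissible_of_mem_stage hd
  have hv : v.1 ∈ ptBelow n w.1 := lt_iff.1 (h.symm ▸ Set.self_mem_Iic : v ∈ Set.Iio w)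
  refine hA.reduced v.1 (hA.subset hv) ?_
  ext u
  constructor
  · intro hu
    have hue := hA.subset hu
    have : of hue ∈ Set.Iic v := h ▸ lt_iff.2 hu
    exact ⟨hue, this⟩
  · rintro ⟨hue, huv⟩
    have : of hue ∈ Set.Iio w := h ▸ huv
    exact lt_iff.1 this

/-- The model is generic: every reduced pair `(β, Y)` is realized by a point. -/
theorem exists_point {β : Finset (Fin n)} {Y : Set (K n)} (hfin : Y.Finite) (hlow : IsLowerSet Y)
    (hval : ∀ v ∈ Y, β ⊆ v.val) (hred : ∀ v, Y = Set.Iic v → β ≠ v.val) :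
    ∃ w : K n, w.val = β ∧ Set.Iio w = Y := by
  classical
  set Z : Finset ℕ := hfin.toFinset.image fun x : K n => x.1 with hZ
  have memZ : ∀ x : K n, x.1 ∈ Z ↔ x ∈ Y := by
    intro x
    simp only [hZ, Finset.mem_image, Set.Finite.mem_toFinset]
    exact ⟨fun ⟨y, hy, h⟩ => Subtype.ext h ▸ hy, fun h => ⟨x, h, rfl⟩⟩
  have exZ : ∀ x ∈ Z, ∃ y ∈ Y, y.1 = x := by
    intro x hx
    simpa [hZ] using hx
  suffices h : ∃ d, pt β Z ∈ stage n d by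
    obtain ⟨d, h⟩ := h
    refine ⟨of h, by simp [K.val, ptVal], ?_⟩
    ext x
    rw [Set.mem_Iio, lt_iff, ← memZ]
    simp [ptBelow]
  by_cases hemp : Z = ∅
  · exact ⟨1, β, by rw [hemp]⟩
  have hex : ∃ d, (Z : Set ℕ) ⊆ stage n d := by
    have : ∀ x ∈ Z, ∃ d, x ∈ stage n d := by
      intro x hx
      obtain ⟨y, -, rfl⟩ := exZ x hx
      exact y.2
    choose! f hf using this
    exact ⟨Z.sup f, fun x hx => stage_mono n (Finset.le_sup hx) (hf x hx)⟩
  obtain ⟨d, hd, hmin⟩ : ∃ d, (Z : Set ℕ) ⊆ stage n d ∧ ∀ e < d, ¬ (Z : Set ℕ) ⊆ stage n e :=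
    ⟨Nat.find hex, Nat.find_spec hex, fun e => Nat.find_min hex⟩
  cases d with
  | zero =>
    obtain ⟨x, hx⟩ := Finset.nonempty_iff_ne_empty.2 hemp
    exact (hd hx).elim
  | succ d =>
    refine ⟨d + 2, Or.inr ⟨β, Z, rfl, ⟨hd, ?_, ?_, ?_⟩, hmin d (by omega)⟩⟩
    · intro v hv u hu huv
      obtain ⟨y, hy, rfl⟩ := exZ v hv
      exact (memZ (of hu)).2 (hlow (le_def.2 huv) hy)
    · intro v hv
      obtain ⟨y, hy, rfl⟩ := exZ v hv
      exact hval y hy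
    · intro v hv h
      refine hred (of hv) ?_
      ext x
      rw [← memZ, ← Finset.mem_coe, h]
      refine ⟨fun hx => hx.2, fun hx => ⟨?_, hx⟩⟩
      rcases hx with hx | hx
      · exact mem_stage_of_below hv hx
      · exact hx ▸ hv

/-- Without reducedness of `(β, Y)` there is still a point at which, together with `Y`, the same
Kripke model is realized: if `Y` is generated by a point with valuation `β`, that point will do. -/
theorem exists_Iic_eq_insert {β : Finset (Fin n)} {Y : Set (K n)} (hfin : Y.Finite)
    (hlow : IsLowerSet Y) (hval : ∀ v ∈ Y, β ⊆ v.val) :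
    ∃ w : K n, w.val = β ∧ Set.Iic w = insert w Y := by
  by_cases h : ∃ v, Y = Set.Iic v ∧ β = v.val
  · obtain ⟨v, rfl, rfl⟩ := h
    exact ⟨v, rfl, by simp⟩
  · push Not at h
    obtain ⟨w, hw, rfl⟩ := exists_point hfin hlow hval h
    exact ⟨w, hw, Set.Iio_insert.symm⟩

end K

/-- A point outside a stage dominates a point that enters exactly at the next stage. -/
theorem exists_ptLe_mem_stage_succ {d i u : ℕ} (hu : u ∈ stage n d) (hi : u ∉ stage n i) :
    ∃ v, ptLe n v u ∧ v ∈ stage n (i + 1) ∧ v ∉ stage n i := by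
  induction d generalizing u with
  | zero => exact hu.elim
  | succ d ih =>
    by_cases hud : u ∈ stage n d
    · exact ih hud hi
    rcases lt_trichotomy d i with h | rfl | h
    · exact (hi (stage_mono n h hu)).elim
    · exact ⟨u, Or.inr rfl, hu, hi⟩
    · cases d with
      | zero => omega
      | succ d =>
        rcases hu with hu | ⟨β, Y, rfl, hA, hY⟩
        · exact (hud hu).elim
        · obtain ⟨y, hy, hyd⟩ := Set.not_subset.1 hY
          obtain ⟨v, hv, hvi⟩ := ih (hA.subset hy) fun h' => hyd (stage_mono n (by omega) h')
          refine ⟨v, Or.inl ?_, hvi⟩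
          have hys := hA.subset hy
          rcases hv with hv | rfl
          · simpa [ptBelow] using
              hA.decreasing y hy v (mem_stage_of_below hys hv) (Or.inl hv)
          · simpa [ptBelow] using hy

/-- Decreasing sets contained in a stage are isolated: a decreasing set with the same trace on the
next stage has no point that enters there, hence no later point either. -/
theorem eq_of_cut_eq {a b : FrHat n} {i : ℕ} (hb : ∀ w ∈ b, w.1 ∈ stage n i)
    (h : cut i a = cut i b) : a = b := by
  have ha : ∀ w ∈ a, w.1 ∈ stage n i := by
    intro w hw
    by_contra hwi
    obtain ⟨d, hd⟩ := w.2
    obtain ⟨v, hvw, hv, hvi⟩ := exists_ptLe_mem_stage_succ hd hwi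
    have hva : K.of hv ∈ cut i a := ⟨a.lower (K.le_def.2 hvw) hw, hv⟩
    rw [h] at hva
    exact hvi (hb _ hva.1)
  ext w
  constructor
  · intro hw
    have : w ∈ cut i a := ⟨hw, stage_mono_succ n i (ha w hw)⟩
    exact (h ▸ this : w ∈ cut i b).1
  · intro hw
    have : w ∈ cut i b := ⟨hw, stage_mono_succ n i (hb w hw)⟩
    exact (h ▸ this : w ∈ cut i a).1

end Points

/-! ### Completeness: the free algebra embeds into the algebra of decreasing sets -/

section Completeness

variable {n : ℕ}

theorem mem_himp_iff {a b : FrHat n} {w : K n} : w ∈ a ⇨ b ↔ ∀ u ≤ w, u ∈ a → u ∈ b := by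
  rw [← LowerSet.Iic_le, le_himp_iff]
  exact ⟨fun h u hu ha => h ⟨hu, ha⟩, fun h u hu => h u hu.1 hu.2⟩

/-- Prime ideals refute implications: the prime ideal plays the part of the complement of a prime
filter, and passing to a smaller prime ideal is passing to a larger theory. -/
theorem exists_isPrime_of_himp_mem {H : Type*} [HeytingAlgebra H] {J : Order.Ideal H} {a b : H}
    (hJ : J.IsPrime) (h : a ⇨ b ∈ J) :
    ∃ J' : Order.Ideal H, J'.IsPrime ∧ J' ≤ J ∧ a ∉ J' ∧ b ∈ J' := by
  have hF : Order.IsPFilter {x : H | ∃ c, c ∉ J ∧ c ⊓ a ≤ x} := by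
    refine Order.IsPFilter.of_def ⟨⊤, ⊤, hJ.toIsProper.top_notMem, le_top⟩ ?_ ?_
    · rintro x ⟨c, hc, hx⟩ y ⟨d, hd, hy⟩
      refine ⟨x ⊓ y, ⟨c ⊓ d, fun hcd => (hJ.mem_or_mem hcd).elim hc hd, ?_⟩,
        inf_le_left, inf_le_right⟩
      exact le_inf ((inf_le_inf_right a inf_le_left).trans hx)
        ((inf_le_inf_right a inf_le_right).trans hy)
    · rintro x y hxy ⟨c, hc, hx⟩
      exact ⟨c, hc, hx.trans hxy⟩
  have hdisj : Disjoint (hF.toPFilter : Set H) (Order.Ideal.principal b : Set H) := by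
    rw [Set.disjoint_left]
    rintro x ⟨c, hc, hx⟩ hxb
    exact hc (J.lower (le_himp_iff.2 (hx.trans hxb)) h)
  obtain ⟨J', hJ', hb, hd⟩ := DistribLattice.prime_ideal_of_disjoint_filter_ideal hdisj
  rw [Set.disjoint_left] at hd
  refine ⟨J', hJ', fun x hx => ?_, fun ha => ?_, hb Order.Ideal.mem_principal_self⟩
  · by_contra hxJ
    exact hd (show x ∈ hF.toPFilter from ⟨x, hxJ, inf_le_left⟩) hx
  · exact hd (show a ∈ hF.toPFilter from ⟨⊤, hJ.toIsProper.top_notMem, inf_le_right⟩) ha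

/-- Closure of a set of terms under immediate subterms. -/
structure SubtermClosed {α : Type*} (S : Set (HTerm α)) : Prop where
  inf {a b} : HTerm.inf a b ∈ S → a ∈ S ∧ b ∈ S
  sup {a b} : HTerm.sup a b ∈ S → a ∈ S ∧ b ∈ S
  imp {a b} : HTerm.imp a b ∈ S → a ∈ S ∧ b ∈ S

namespace SubtermClosed

variable {α : Type*}

theorem union {S T : Set (HTerm α)} (hS : SubtermClosed S) (hT : SubtermClosed T) :
    SubtermClosed (S ∪ T) where
  inf h := h.elim (fun h => ⟨.inl (hS.inf h).1, .inl (hS.inf h).2⟩)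
    fun h => ⟨.inr (hT.inf h).1, .inr (hT.inf h).2⟩
  sup h := h.elim (fun h => ⟨.inl (hS.sup h).1, .inl (hS.sup h).2⟩)
    fun h => ⟨.inr (hT.sup h).1, .inr (hT.sup h).2⟩
  imp h := h.elim (fun h => ⟨.inl (hS.imp h).1, .inl (hS.imp h).2⟩)
    fun h => ⟨.inr (hT.imp h).1, .inr (hT.imp h).2⟩

theorem range_var : SubtermClosed (Set.range (HTerm.var (α := α))) where
  inf := by simp
  sup := by simp
  imp := by simp

theorem insert {S : Set (HTerm α)} (hS : SubtermClosed S) {t : HTerm α}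
    (h : ∀ a b, t = .inf a b ∨ t = .sup a b ∨ t = .imp a b → a ∈ S ∧ b ∈ S) :
    SubtermClosed (insert t S) where
  inf k := (k.elim (fun k => h _ _ (.inl k.symm)) hS.inf).imp .inr .inr
  sup k := (k.elim (fun k => h _ _ (.inr (.inl k.symm))) hS.sup).imp .inr .inr
  imp k := (k.elim (fun k => h _ _ (.inr (.inr k.symm))) hS.imp).imp .inr .inr

theorem exists_finite_mem (t : HTerm α) : ∃ S, S.Finite ∧ SubtermClosed S ∧ t ∈ S := by
  induction t with
  | var i => exact ⟨{.var i}, Set.finite_singleton _, ⟨by simp, by simp, by simp⟩, rfl⟩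
  | bot => exact ⟨{.bot}, Set.finite_singleton _, ⟨by simp, by simp, by simp⟩, rfl⟩
  | top => exact ⟨{.top}, Set.finite_singleton _, ⟨by simp, by simp, by simp⟩, rfl⟩
  | inf a b iha ihb =>
    obtain ⟨S, hS, cS, aS⟩ := iha
    obtain ⟨T, hT, cT, bT⟩ := ihb
    refine ⟨_, (hS.union hT).insert (.inf a b), (cS.union cT).insert ?_, .inl rfl⟩
    rintro _ _ (h | h | h) <;> cases h
    exact ⟨.inl aS, .inr bT⟩
  | sup a b iha ihb =>
    obtain ⟨S, hS, cS, aS⟩ := iha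
    obtain ⟨T, hT, cT, bT⟩ := ihb
    refine ⟨_, (hS.union hT).insert (.sup a b), (cS.union cT).insert ?_, .inl rfl⟩
    rintro _ _ (h | h | h) <;> cases h
    exact ⟨.inl aS, .inr bT⟩
  | imp a b iha ihb =>
    obtain ⟨S, hS, cS, aS⟩ := iha
    obtain ⟨T, hT, cT, bT⟩ := ihb
    refine ⟨_, (hS.union hT).insert (.imp a b), (cS.union cT).insert ?_, .inl rfl⟩
    rintro _ _ (h | h | h) <;> cases h
    exact ⟨.inl aS, .inr bT⟩

end SubtermClosed

open FreeHeyting in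
/-- Every prime ideal of the free algebra is matched, on a finite set `S` of terms, by a point of
the generic Kripke model. The induction is on the number of terms of `S` that the ideal contains:
the points strictly below the one to be found match the smaller prime ideals that differ on `S`. -/
theorem exists_point_of_isPrime {S : Set (HTerm (Fin n))} (hfin : S.Finite)
    (hS : SubtermClosed S) (hvar : ∀ i, .var i ∈ S) (J : Order.Ideal (Fr n)) (hJ : J.IsPrime) :
    ∃ w : K n, ∀ t ∈ S, w ∈ toHat n (mk t) ↔ mk t ∉ J := by
  classical
  -- The trace of a prime ideal on `S`.
  let tr : Order.Ideal (Fr n) → Set (HTerm (Fin n)) := fun I => {t ∈ S | mk t ∈ I}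
  have trfin : ∀ I, (tr I).Finite := fun I => hfin.subset fun _ h => h.1
  induction hk : (tr J).ncard using Nat.strong_induction_on generalizing J with
  | _ k ih =>
  let Ts : Set (Set (HTerm (Fin n))) :=
    {T | ∃ I : Order.Ideal (Fr n), I.IsPrime ∧ I ≤ J ∧ tr I ≠ tr J ∧ T = tr I}
  have hTs : Ts.Finite := by
    refine hfin.powerset.subset ?_
    rintro _ ⟨I, -, -, -, rfl⟩
    exact fun _ h => h.1
  have hpt : ∀ T ∈ Ts, ∃ w : K n, ∀ t ∈ S, w ∈ toHat n (mk t) ↔ t ∉ T := by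
    rintro _ ⟨I, hI, hIJ, hne, rfl⟩
    have hlt : (tr I).ncard < k := by
      rw [← hk]
      exact Set.ncard_lt_ncard (lt_of_le_of_ne (fun t ht => ⟨ht.1, hIJ ht.2⟩) hne) (trfin J)
    obtain ⟨w, hw⟩ := ih _ hlt I hI rfl
    exact ⟨w, fun t ht => (hw t ht).trans ⟨fun h h' => h h'.2, fun h h' => h ⟨ht, h'⟩⟩⟩
  have : Nonempty (K n) := ⟨K.of (d := 1) ⟨∅, rfl⟩⟩
  choose! p hp using hpt
  let Y : Set (K n) := ⋃ T ∈ Ts, Set.Iic (p T)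
  have hYfin : Y.Finite := hTs.biUnion fun T _ => K.finite_Iic _
  have hYlow : IsLowerSet Y := isLowerSet_iUnion₂ fun T _ => isLowerSet_Iic _
  -- Every point of `Y` validates the terms outside `J`.
  have hYval : ∀ u ∈ Y, ∀ t ∈ S, mk t ∉ J → u ∈ toHat n (mk t) := by
    intro u hu t ht htJ
    obtain ⟨T, hT, hle⟩ := Set.mem_iUnion₂.1 hu
    refine (toHat n (mk t)).lower hle ((hp T hT t ht).2 fun htT => ?_)
    obtain ⟨I, -, hIJ, -, rfl⟩ := hT
    exact htJ (hIJ htT.2)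
  obtain ⟨w, hwval, hwY⟩ := K.exists_Iic_eq_insert
    (β := Finset.univ.filter fun i => mk (.var i) ∉ J) hYfin hYlow (by
      intro v hv i hi
      exact hYval v hv (.var i) (hvar i) (Finset.mem_filter.1 hi).2)
  refine ⟨w, fun t => ?_⟩
  induction t with
  | var i =>
    intro _
    change i ∈ w.val ↔ _
    rw [hwval]
    simp
  | bot =>
    intro _
    have : mk (.bot : HTerm (Fin n)) = ⊥ := rfl
    rw [this, map_bot]
    exact ⟨fun h => h.elim, fun h => (h J.bot_mem).elim⟩
  | top =>
    intro _
    have : mk (.top : HTerm (Fin n)) = ⊤ := rfl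
    rw [this, map_top]
    exact ⟨fun _ => hJ.toIsProper.top_notMem, fun _ => trivial⟩
  | inf a b iha ihb =>
    intro ht
    have : mk (.inf a b) = mk a ⊓ mk b := rfl
    rw [this, map_inf, LowerSet.mem_inf_iff, iha (hS.inf ht).1, ihb (hS.inf ht).2]
    exact ⟨fun h h' => (hJ.mem_or_mem h').elim h.1 h.2,
      fun h => ⟨fun h' => h (J.lower inf_le_left h'), fun h' => h (J.lower inf_le_right h')⟩⟩
  | sup a b iha ihb =>
    intro ht
    have : mk (.sup a b) = mk a ⊔ mk b := rfl
    rw [this, map_sup, LowerSet.mem_sup_iff, iha (hS.sup ht).1, ihb (hS.sup ht).2,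
      Order.Ideal.sup_mem_iff]
    tauto
  | imp a b iha ihb =>
    intro ht
    have hab : mk (.imp a b) = mk a ⇨ mk b := rfl
    have iha := iha (hS.imp ht).1
    have ihb := ihb (hS.imp ht).2
    constructor
    · intro h hJab
      rw [hab, map_himp, mem_himp_iff] at h
      obtain ⟨I, hI, hIJ, haI, hbI⟩ := exists_isPrime_of_himp_mem hJ (hab ▸ hJab)
      by_cases htr : tr I = tr J
      · -- `I` and `J` agree on `S`, so that `w` itself refutes the implication.
        refine ihb.1 (h w le_rfl (iha.2 fun haJ => haI ?_)) (hIJ hbI)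
        have : a ∈ tr J := ⟨(hS.imp ht).1, haJ⟩
        rw [← htr] at this
        exact this.2
      · have hT : tr I ∈ Ts := ⟨I, hI, hIJ, htr, rfl⟩
        have hpw : p (tr I) ≤ w := by
          have : p (tr I) ∈ insert w Y :=
            Or.inr (Set.mem_iUnion₂.2 ⟨tr I, hT, Set.self_mem_Iic⟩)
          rwa [← hwY] at this
        exact (hp _ hT b (hS.imp ht).2).1
          (h _ hpw ((hp _ hT a (hS.imp ht).1).2 fun h' => haI h'.2)) ⟨(hS.imp ht).2, hbI⟩
    · intro hJab
      have hYab : ∀ u ∈ Y, u ∈ toHat n (mk a) → u ∈ toHat n (mk b) := by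
        intro u hu
        have := hYval u hu _ ht hJab
        rw [hab, map_himp, mem_himp_iff] at this
        exact this u le_rfl
      rw [hab, map_himp, mem_himp_iff]
      intro u hu hua
      have hu : u ∈ insert w Y := hwY ▸ hu
      rcases hu with rfl | hu
      · refine ihb.2 fun hbJ => hJab ?_
        rw [hab]
        refine (hJ.mem_or_mem (x := mk a) (y := mk a ⇨ mk b) ?_).resolve_left (iha.1 hua)
        exact J.lower (by simp) hbJ
      · exact hYab u hu hua

/-- Kripke completeness, that is, Bellissima's embedding theorem. -/
theorem toHat_injective (n : ℕ) : Function.Injective (toHat n) := by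
  have key : ∀ x y : Fr n, toHat n x ≤ toHat n y → x ≤ y := by
    rintro ⟨s⟩ ⟨t⟩ h
    change FreeHeyting.mk s ≤ FreeHeyting.mk t
    by_contra hst
    have hdisj : Disjoint (Order.PFilter.principal (FreeHeyting.mk s) : Set (Fr n))
        (Order.Ideal.principal (FreeHeyting.mk t) : Set (Fr n)) :=
      Set.disjoint_left.2 fun x hx hx' => hst (le_trans (b := x) hx hx')
    obtain ⟨J, hJ, ht, hs⟩ := DistribLattice.prime_ideal_of_disjoint_filter_ideal hdisj
    obtain ⟨S, hS, cS, sS⟩ := SubtermClosed.exists_finite_mem s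
    obtain ⟨T, hT, cT, tT⟩ := SubtermClosed.exists_finite_mem t
    obtain ⟨w, hw⟩ := exists_point_of_isPrime ((hS.union hT).union (Set.finite_range _))
      ((cS.union cT).union SubtermClosed.range_var) (fun i => .inr ⟨i, rfl⟩) J hJ
    have hws := (hw s (.inl (.inl sS))).2 (Set.disjoint_left.1 hs (le_refl (FreeHeyting.mk s)))
    exact (hw t (.inl (.inr tT))).1 (h hws) (ht Order.Ideal.mem_principal_self)
  intro x y h
  exact le_antisymm (key x y h.le) (key y x h.ge)

end Completeness

/-! ### Definability of points in the free algebra -/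

section DeJongh

variable {n : ℕ}

theorem mem_range_finset_sup {ι : Type*} (s : Finset ι) (f : ι → FrHat n)
    (h : ∀ i ∈ s, f i ∈ Set.range (toHat n)) : s.sup f ∈ Set.range (toHat n) := by
  refine Finset.sup_induction ⟨⊥, map_bot _⟩ ?_ h
  rintro _ ⟨x, rfl⟩ _ ⟨y, rfl⟩
  exact ⟨x ⊔ y, map_sup _ _ _⟩

theorem mem_range_finset_inf {ι : Type*} (s : Finset ι) (f : ι → FrHat n)
    (h : ∀ i ∈ s, f i ∈ Set.range (toHat n)) : s.inf f ∈ Set.range (toHat n) := by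
  refine Finset.inf_induction ⟨⊤, map_top _⟩ ?_ h
  rintro _ ⟨x, rfl⟩ _ ⟨y, rfl⟩
  exact ⟨x ⊓ y, map_inf _ _ _⟩

theorem himp_mem_range {a b : FrHat n} (ha : a ∈ Set.range (toHat n))
    (hb : b ∈ Set.range (toHat n)) : a ⇨ b ∈ Set.range (toHat n) := by
  obtain ⟨x, rfl⟩ := ha
  obtain ⟨y, rfl⟩ := hb
  exact ⟨x ⇨ y, map_himp _ _ _⟩

theorem varSet_mem_range (i : Fin n) : varSet i ∈ Set.range (toHat n) :=
  ⟨FreeHeyting.gen i, rfl⟩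

theorem mem_finset_sup {ι : Type*} {s : Finset ι} {f : ι → FrHat n} {w : K n} :
    w ∈ s.sup f ↔ ∃ i ∈ s, w ∈ f i := by
  simp [Finset.sup_eq_iSup, LowerSet.mem_iSup_iff]

theorem mem_finset_inf {ι : Type*} {s : Finset ι} {f : ι → FrHat n} {w : K n} :
    w ∈ s.inf f ↔ ∀ i ∈ s, w ∈ f i := by
  simp [Finset.inf_eq_iInf, LowerSet.mem_iInf_iff]

theorem finset_sup_Iic (w : K n) :
    (K.finite_Iio w).toFinset.sup LowerSet.Iic = LowerSet.Iio w := by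
  ext u
  simp only [SetLike.mem_coe, mem_finset_sup, Set.Finite.mem_toFinset, Set.mem_Iio,
    LowerSet.mem_Iic_iff, LowerSet.mem_Iio_iff]
  exact ⟨fun ⟨v, hv, huv⟩ => huv.trans_lt hv, fun h => ⟨u, h, le_rfl⟩⟩

/-- The set of points that are not above `w`, as an implication. -/
theorem mem_Iic_himp_Iio_iff {u w : K n} :
    u ∈ LowerSet.Iic w ⇨ LowerSet.Iio w ↔ ¬ w ≤ u := by
  rw [mem_himp_iff]
  simp only [LowerSet.mem_Iic_iff, LowerSet.mem_Iio_iff]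
  refine ⟨fun h hwu => lt_irrefl w (h w hwu le_rfl), fun h v hvu hvw => lt_of_le_of_ne hvw ?_⟩
  rintro rfl
  exact h hvu

/-- The de Jongh formula of `w`. A point satisfies it iff its valuation contains that of `w` and
every point below it either lies strictly below `w`, or has no variable outside the valuation of
`w` and lies above all points strictly below `w`. -/
theorem Iic_eq_deJongh (w : K n) :
    LowerSet.Iic w = w.val.inf varSet ⊓
      ((w.valᶜ.sup varSet ⊔
        (K.finite_Iio w).toFinset.sup fun v => LowerSet.Iic v ⇨ LowerSet.Iio v) ⇨
        LowerSet.Iio w) := by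
  ext u
  rw [SetLike.mem_coe, SetLike.mem_coe, LowerSet.mem_inf_iff, mem_finset_inf, mem_himp_iff]
  simp only [LowerSet.mem_sup_iff, mem_finset_sup, Set.Finite.mem_toFinset, Set.mem_Iio,
    mem_Iic_himp_Iio_iff, LowerSet.mem_Iic_iff, LowerSet.mem_Iio_iff, Finset.mem_compl]
  constructor
  · intro h
    refine ⟨fun i hi => K.val_anti h hi, fun u' hu' hor => lt_of_le_of_ne (hu'.trans h) ?_⟩
    rintro rfl
    rcases hor with ⟨i, hi, hi'⟩ | ⟨v, hv, hv'⟩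
    · exact hi hi'
    · exact hv' hv.le
  · rintro ⟨h1, h2⟩
    induction u using WellFoundedLT.induction with
    | _ u ih =>
    by_cases huw : u < w
    · exact huw.le
    by_cases hu : (∃ i, i ∉ w.val ∧ u ∈ varSet i) ∨ ∃ v < w, ¬ v ≤ u
    · exact (h2 u le_rfl hu).le
    push Not at hu
    have hval : u.val = w.val :=
      Finset.Subset.antisymm (fun i hi => by_contra fun h => hu.1 i h hi) fun i hi => h1 i hi
    have hbelow : ∀ v < u, v ≤ w := fun v hv =>
      ih v hv (fun i hi => K.val_anti hv.le (h1 i hi)) fun u' hu' => h2 u' (hu'.trans hv.le)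
    by_cases hwu : w < u
    · -- `u` covers only `w` and has the same valuation, against reducedness.
      refine absurd hval (K.val_ne_of_Iio_eq_Iic ?_)
      ext v
      exact ⟨fun hv => hbelow v hv, fun hv => lt_of_le_of_lt hv hwu⟩
    · refine (K.eq_of_val_eq hval ?_).le
      ext v
      constructor
      · intro hv
        refine lt_of_le_of_ne (hbelow v hv) ?_
        rintro rfl
        exact hwu hv
      · intro hv
        refine lt_of_le_of_ne (hu.2 v hv) ?_
        rintro rfl
        exact huw hv

theorem Iio_mem_range_of_Iic {w : K n} (h : ∀ u < w, LowerSet.Iic u ∈ Set.range (toHat n)) :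
    LowerSet.Iio w ∈ Set.range (toHat n) := by
  rw [← finset_sup_Iic]
  exact mem_range_finset_sup _ _ fun u hu => h u (by simpa using hu)

theorem Iic_mem_range (w : K n) : LowerSet.Iic w ∈ Set.range (toHat n) := by
  induction w using WellFoundedLT.induction with
  | _ w ih =>
  rw [Iic_eq_deJongh]
  obtain ⟨x, hx⟩ := mem_range_finset_inf w.val varSet fun i _ => varSet_mem_range i
  obtain ⟨y, hy⟩ := mem_range_finset_sup w.valᶜ varSet fun i _ => varSet_mem_range i
  obtain ⟨z, hz⟩ := mem_range_finset_sup (K.finite_Iio w).toFinset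
    (fun v => LowerSet.Iic v ⇨ LowerSet.Iio v) fun v hv => by
      have hv : v < w := by simpa using hv
      exact himp_mem_range (ih v hv) (Iio_mem_range_of_Iic fun u hu => ih u (hu.trans hv))
  obtain ⟨t, ht⟩ := Iio_mem_range_of_Iic ih
  exact ⟨x ⊓ ((y ⊔ z) ⇨ t), by
    rw [map_inf, map_himp, map_sup, hx, hy, hz, ht]⟩

theorem Iio_mem_range (w : K n) : LowerSet.Iio w ∈ Set.range (toHat n) :=
  Iio_mem_range_of_Iic fun u _ => Iic_mem_range u

end DeJongh

/-! ### Recovering the valuation from the order of the generic Kripke model -/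

section Order

variable {n : ℕ}

theorem K.Iic_injective : Function.Injective (LowerSet.Iic : K n → FrHat n) := fun u v h =>
  Set.Iic_injective (by simpa using congrArg (fun a : FrHat n => (a : Set (K n))) h)

theorem K.Iio_lowerSet_iff {w : K n} {a : FrHat n} : LowerSet.Iio w = a ↔ Set.Iio w = a := by
  rw [← SetLike.coe_set_eq, LowerSet.coe_Iio]

/-- A point is covered, as a single point, by exactly one point iff exactly one variable is
valid at it: the covers correspond to the proper subsets of its valuation. -/
theorem K.existsUnique_cover_iff {p : K n} :
    (∃ v : K n, LowerSet.Iio v = LowerSet.Iic p ∧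
      ∀ v' : K n, LowerSet.Iio v' = LowerSet.Iic p → v' = v) ↔ ∃ i, p.val = {i} := by
  have hIic : ∀ v, Set.Iic p = Set.Iic v → v = p := fun v h => (Set.Iic_injective h).symm
  have hmono : ∀ u ∈ Set.Iic p, p.val ⊆ u.val := fun u hu => K.val_anti hu
  have hcov : ∀ β : Finset (Fin n), β ⊂ p.val →
      ∃ v : K n, v.val = β ∧ Set.Iio v = Set.Iic p := fun β hβ =>
    K.exists_point (K.finite_Iic p) (isLowerSet_Iic p) (fun u hu => hβ.subset.trans (hmono u hu))
      fun v hv h => hβ.ne (h.trans (by rw [hIic v hv]))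
  simp only [K.Iio_lowerSet_iff, LowerSet.coe_Iic]
  constructor
  · rintro ⟨v, hv, huniq⟩
    have hpv : p < v := by rw [← Set.mem_Iio, hv]; exact Set.self_mem_Iic
    have hss : v.val ⊂ p.val :=
      lt_of_le_of_ne (K.val_anti hpv.le) (K.val_ne_of_Iio_eq_Iic hv)
    obtain ⟨i, hi, -⟩ := Finset.exists_of_ssubset hss
    refine ⟨i, by_contra fun hne => ?_⟩
    obtain ⟨v₁, h₁, h₁'⟩ := hcov ∅ (Finset.empty_ssubset.2 ⟨i, hi⟩)
    obtain ⟨v₂, h₂, h₂'⟩ := hcov {i}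
      (lt_of_le_of_ne (Finset.singleton_subset_iff.2 hi) (Ne.symm hne))
    have := (huniq v₁ h₁').trans (huniq v₂ h₂').symm
    rw [this, h₂] at h₁
    exact Finset.singleton_ne_empty i h₁
  · rintro ⟨i, hi⟩
    obtain ⟨v, hv, hv'⟩ := hcov ∅ (by simp [hi])
    refine ⟨v, hv', fun v' h => K.eq_of_val_eq ?_ (h.trans hv'.symm)⟩
    have hpv : p < v' := by rw [← Set.mem_Iio, h]; exact Set.self_mem_Iic
    have := lt_of_le_of_ne (K.val_anti hpv.le) (K.val_ne_of_Iio_eq_Iic h)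
    rw [hi] at this
    rw [hv]
    exact Finset.ssubset_singleton_iff.1 this

/-- The variable `P_i` is valid at `w` iff there is a choice for the valuation of a point that covers
exactly `w` and the minimal point `p` with valuation `{i}`. If `p` is not below `w`, the possible
valuations are the subsets of `w.val ∩ {i}`. If `p ≤ w`, then `w.val` is contained in `{i}`, and the
possible valuations are its proper subsets. -/
theorem K.mem_val_iff {p w : K n} {i : Fin n} (hp : LowerSet.Iio p = ⊥) (hi : p.val = {i}) :
    ((¬ p ≤ w ∧ ∃ v v' : K n, v ≠ v' ∧ LowerSet.Iio v = LowerSet.Iic w ⊔ LowerSet.Iic p ∧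
        LowerSet.Iio v' = LowerSet.Iic w ⊔ LowerSet.Iic p) ∨
      (p ≤ w ∧ ∃ v : K n, LowerSet.Iio v = LowerSet.Iic w)) ↔ i ∈ w.val := by
  simp only [K.Iio_lowerSet_iff, LowerSet.coe_sup, LowerSet.coe_Iic]
  have hmin : ∀ u ≤ p, u = p := by
    intro u hu
    by_contra hne
    have : u ∈ LowerSet.Iio p := lt_of_le_of_ne hu hne
    rw [hp] at this
    exact this
  constructor
  · rintro (⟨hpw, v, v', hne, hv, hv'⟩ | ⟨hpw, v, hv⟩)
    · by_contra hiw
      have key : ∀ v : K n, Set.Iio v = Set.Iic w ∪ Set.Iic p → v.val = ∅ := by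
        intro v hv
        have hw : w < v := by rw [← Set.mem_Iio, hv]; exact .inl Set.self_mem_Iic
        have hp : p < v := by rw [← Set.mem_Iio, hv]; exact .inr Set.self_mem_Iic
        refine Finset.eq_empty_of_forall_notMem fun j hj => hiw ?_
        have := K.val_anti hp.le hj
        rw [hi, Finset.mem_singleton] at this
        exact this ▸ K.val_anti hw.le hj
      exact hne (K.eq_of_val_eq ((key v hv).trans (key v' hv').symm) (hv.trans hv'.symm))
    · have hw : w < v := by rw [← Set.mem_Iio, hv]; exact Set.self_mem_Iic
      obtain ⟨j, hj, -⟩ := Finset.exists_of_ssubset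
        (lt_of_le_of_ne (K.val_anti hw.le) (K.val_ne_of_Iio_eq_Iic hv))
      have := K.val_anti hpw hj
      rw [hi, Finset.mem_singleton] at this
      exact this ▸ hj
  · intro hiw
    by_cases hpw : p ≤ w
    · refine .inr ⟨hpw, ?_⟩
      obtain ⟨v, -, hv⟩ := K.exists_point (β := ∅) (K.finite_Iic w) (isLowerSet_Iic w)
        (fun _ _ => Finset.empty_subset _) fun v hv h => by
          rw [← Set.Iic_injective hv] at h
          exact Finset.notMem_empty i (h ▸ hiw)
      exact ⟨v, hv⟩
    · refine .inl ⟨hpw, ?_⟩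
      have hnp : ∀ v, Set.Iic w ∪ Set.Iic p ≠ Set.Iic v := by
        intro v hv
        have hwv : w ≤ v := by rw [← Set.mem_Iic, ← hv]; exact .inl Set.self_mem_Iic
        have hpv : p ≤ v := by rw [← Set.mem_Iic, ← hv]; exact .inr Set.self_mem_Iic
        rcases (hv ▸ Set.self_mem_Iic : v ∈ Set.Iic w ∪ Set.Iic p) with h | h
        · exact hpw (hpv.trans h)
        · exact hpw (hmin w (hwv.trans h)).ge
      have hfin := (K.finite_Iic w).union (K.finite_Iic p)
      have hlow := (isLowerSet_Iic w).union (isLowerSet_Iic p)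
      obtain ⟨v, hv, hv'⟩ := K.exists_point (β := ∅) hfin hlow
        (fun _ _ => Finset.empty_subset _) fun v hv => (hnp v hv).elim
      obtain ⟨v₁, hv₁, hv₁'⟩ := K.exists_point (β := {i}) hfin hlow (by
        rintro u (hu | hu)
        · exact Finset.singleton_subset_iff.2 (K.val_anti hu hiw)
        · exact hi ▸ K.val_anti hu) fun v hv => (hnp v hv).elim
      refine ⟨v, v₁, ?_, hv', hv₁'⟩
      rintro rfl
      exact Finset.singleton_ne_empty i (hv₁.symm.trans hv)

theorem K.exists_minimal_val_eq (β : Finset (Fin n)) :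
    ∃ p : K n, LowerSet.Iio p = ⊥ ∧ p.val = β := by
  obtain ⟨p, hp, hp'⟩ := K.exists_point (β := β) (Y := ∅) Set.finite_empty isLowerSet_empty
    (by simp) fun v hv => by
      have : v ∈ (∅ : Set (K n)) := hv ▸ Set.self_mem_Iic
      exact this.elim
  exact ⟨p, K.Iio_lowerSet_iff.2 hp', hp⟩

theorem varSet_injective : Function.Injective (varSet : Fin n → FrHat n) := by
  intro i j h
  obtain ⟨p, -, hp⟩ := K.exists_minimal_val_eq ({i} : Finset (Fin n))
  have h₁ : p ∈ varSet i := show i ∈ p.val by simp [hp]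
  rw [h] at h₁
  have h₂ : j ∈ p.val := h₁
  rw [hp, Finset.mem_singleton] at h₂
  exact h₂.symm

/-- Among decreasing sets that include the principal ones, the principal ones are those whose
proper subsets have a greatest element. -/
theorem isGreatest_lt_iff {R : Set (FrHat n)} (hR : ∀ w, LowerSet.Iic w ∈ R) {a b : FrHat n} :
    (b < a ∧ ∀ z ∈ R, z < a → z ≤ b) ↔
      ∃ w : K n, a = LowerSet.Iic w ∧ b = LowerSet.Iio w := by
  have mem : ∀ {w : K n} {c : FrHat n}, LowerSet.Iic w ≤ c ↔ w ∈ c := LowerSet.Iic_le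
  constructor
  · rintro ⟨hba, h⟩
    obtain ⟨w, hwa, hwb⟩ := Set.exists_of_ssubset (LowerSet.coe_ssubset_coe.2 hba)
    have ha : LowerSet.Iic w = a := by
      by_contra hne
      exact hwb (mem.1 (h _ (hR w) (lt_of_le_of_ne (mem.2 hwa) hne)))
    subst ha
    refine ⟨w, rfl, le_antisymm (fun u hu => lt_of_le_of_ne (b := w) (hba.le hu) ?_)
      fun u hu => ?_⟩
    · rintro rfl
      exact hwb hu
    · refine mem.1 (h _ (hR u) (lt_of_le_of_ne (mem.2 (LowerSet.mem_Iio_iff.1 hu).le) fun he => ?_))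
      exact (ne_of_lt hu) (K.Iic_injective he)
  · rintro ⟨w, rfl, rfl⟩
    refine ⟨lt_of_le_of_ne (fun u hu => (LowerSet.mem_Iio_iff.1 hu).le) fun he => ?_,
      fun z _ hz u hu => lt_of_le_of_ne (b := w) (hz.le hu) ?_⟩
    · exact lt_irrefl w (show w ∈ LowerSet.Iio w from he ▸ (le_refl w : w ∈ LowerSet.Iic w))
    · rintro rfl
      exact hz.not_ge (mem.2 hu)

end Order

/-! ### First-order definition of the generators -/

section Formulas

open FirstOrder FirstOrder.Language

variable {α : Type*}

/-- The term `⊥`. -/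
def botT : LHA.Term α := Constants.term (HAFunc.zero : LHA.Functions 0)

/-- The term `t ⊓ s`. -/
def infT (t s : LHA.Term α) : LHA.Term α := Functions.apply₂ (L := LHA) HAFunc.inf t s

/-- The term `t ⊔ s`. -/
def supT (t s : LHA.Term α) : LHA.Term α := Functions.apply₂ (L := LHA) HAFunc.sup t s

/-- The same term, in a context with one more variable. -/
def up (t : LHA.Term α) : LHA.Term (α ⊕ Unit) := t.relabel Sum.inl

/-- The most recently bound variable. -/
def new : LHA.Term (α ⊕ Unit) := Term.var (.inr ())

/-- The formula `t ≤ s`. -/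
def leF (t s : LHA.Term α) : LHA.Formula α := (infT t s).equal t

/-- The formula `∃ x, φ`. -/
noncomputable def exF (φ : LHA.Formula (α ⊕ Unit)) : LHA.Formula α := φ.iExs Unit

/-- The formula `∀ x, φ`. -/
noncomputable def allF (φ : LHA.Formula (α ⊕ Unit)) : LHA.Formula α := φ.iAlls Unit

/-- The formula `t < s`. -/
def ltF (t s : LHA.Term α) : LHA.Formula α := leF t s ⊓ ∼(leF s t)

/-- The formula saying that `s` is the greatest element strictly below `t`; for sets of points:
`t` is generated by a point `w` and `s` is the set of points strictly below `w`. -/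
noncomputable def coverF (t s : LHA.Term α) : LHA.Formula α :=
  ltF s t ⊓ allF ((ltF new (up t)).imp (leF new (up s)))

/-- The formula saying that `t` is generated by a minimal point at which exactly one variable is
valid. -/
noncomputable def unitF (t : LHA.Term α) : LHA.Formula α :=
  coverF t botT ⊓ exF (coverF new (up t) ⊓
    allF ((coverF new (up (up t))).imp (new.equal (up new))))

/-- The formula saying of `s` and `t`, generated by points `w` and `p`, of which `p` is as in
`unitF`, that the variable valid at `p` is valid at `w`. -/
noncomputable def valF (s t : LHA.Term α) : LHA.Formula α :=
  (∼(leF t s) ⊓ exF (exF (∼((up new).equal new) ⊓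
    (coverF (up new) (up (up (supT s t))) ⊓ coverF new (up (up (supT s t))))))) ⊔
  (leF t s ⊓ exF (coverF new (up s)))

/-- The formula that defines the set of generators. -/
noncomputable def genF (t : LHA.Term α) : LHA.Formula α :=
  exF (unitF new ⊓ allF ((exF (coverF (up new) new)).imp
    ((leF new (up (up t))).iff (valF new (up new)))))

/-- The formula saying that the variables stand for all the generators, in some order. -/
noncomputable def basisF (n : ℕ) : LHA.Formula (Fin n) :=
  Formula.iInf (fun i : Fin n => genF (Term.var i)) ⊓
    Formula.iInf fun ij : {ij : Fin n × Fin n // ij.1 ≠ ij.2} =>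
      ∼((Term.var ij.1.1).equal (Term.var ij.1.2))

variable {A : Type*} [LHA.Structure A]

theorem realize_exF {φ : LHA.Formula (α ⊕ Unit)} {v : α → A} :
    (exF φ).Realize v ↔ ∃ a : A, φ.Realize (Sum.elim v fun _ => a) := by
  rw [exF, Formula.realize_iExs]
  exact ⟨fun ⟨f, hf⟩ => ⟨f (), hf⟩, fun ⟨a, ha⟩ => ⟨fun _ => a, ha⟩⟩

theorem realize_allF {φ : LHA.Formula (α ⊕ Unit)} {v : α → A} :
    (allF φ).Realize v ↔ ∀ a : A, φ.Realize (Sum.elim v fun _ => a) := by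
  rw [allF, Formula.realize_iAlls]
  exact ⟨fun h a => h fun _ => a, fun h f => h (f ())⟩

@[simp] theorem realize_up {t : LHA.Term α} {v : α → A} {f : Unit → A} :
    (up t).realize (Sum.elim v f) = t.realize v := by
  rw [up, Term.realize_relabel, Sum.elim_comp_inl]

@[simp] theorem realize_new {v : α → A} {f : Unit → A} :
    (new : LHA.Term (α ⊕ Unit)).realize (Sum.elim v f) = f () := rfl

section Heyting

variable {H : Type*} [HeytingAlgebra H]

@[simp] theorem realize_botT {v : α → H} : (botT : LHA.Term α).realize v = ⊥ :=
  Term.realize_constants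

@[simp] theorem realize_infT {t s : LHA.Term α} {v : α → H} :
    (infT t s).realize v = t.realize v ⊓ s.realize v := Term.realize_functions_apply₂

@[simp] theorem realize_supT {t s : LHA.Term α} {v : α → H} :
    (supT t s).realize v = t.realize v ⊔ s.realize v := Term.realize_functions_apply₂

variable (e : A ↪[LHA] H)

theorem realize_equal_iff {t s : LHA.Term α} {v : α → A} :
    (t.equal s).Realize v ↔ t.realize (e ∘ v) = s.realize (e ∘ v) := by
  rw [Formula.realize_equal, HomClass.realize_term, HomClass.realize_term, e.injective.eq_iff]

theorem realize_leF {t s : LHA.Term α} {v : α → A} :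
    (leF t s).Realize v ↔ t.realize (e ∘ v) ≤ s.realize (e ∘ v) := by
  rw [leF, realize_equal_iff e, realize_infT, inf_eq_left]

theorem realize_ltF {t s : LHA.Term α} {v : α → A} :
    (ltF t s).Realize v ↔ t.realize (e ∘ v) < s.realize (e ∘ v) := by
  rw [ltF, Formula.realize_inf, Formula.realize_not, realize_leF e, realize_leF e, lt_iff_le_not_ge]

end Heyting

variable {n : ℕ} (e : A ↪[LHA] FrHat n)

theorem realize_coverF (hIic : ∀ w, LowerSet.Iic w ∈ Set.range e) {t s : LHA.Term α}
    {v : α → A} : (coverF t s).Realize v ↔ ∃ w : K n,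
      t.realize (e ∘ v) = LowerSet.Iic w ∧ s.realize (e ∘ v) = LowerSet.Iio w := by
  rw [← isGreatest_lt_iff hIic, coverF, Formula.realize_inf, realize_ltF e, realize_allF]
  simp [Formula.realize_imp, realize_ltF e, realize_leF e, Sum.comp_elim]

theorem realize_unitF (hIic : ∀ w, LowerSet.Iic w ∈ Set.range e) {t : LHA.Term α} {v : α → A} :
    (unitF t).Realize v ↔ ∃ (p : K n) (i : Fin n),
      t.realize (e ∘ v) = LowerSet.Iic p ∧ LowerSet.Iio p = ⊥ ∧ p.val = {i} := by
  simp only [unitF, Formula.realize_inf, realize_coverF e hIic, realize_exF, realize_allF,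
    Formula.realize_imp, realize_equal_iff e, Sum.comp_elim, realize_up, realize_new, realize_botT,
    Function.comp_apply]
  constructor
  · rintro ⟨⟨p, hp, hp0⟩, a, ⟨u, hu, hu'⟩, huniq⟩
    obtain ⟨i, hi⟩ := (K.existsUnique_cover_iff (p := p)).1
      ⟨u, by rw [← hu', hp], fun u' h => by
        obtain ⟨b, hb⟩ := hIic u'
        have := huniq b ⟨u', hb, by rw [h, hp]⟩
        rw [hb, hu] at this
        exact K.Iic_injective this⟩
    exact ⟨p, i, hp, hp0.symm, hi⟩
  · rintro ⟨p, i, hp, hp0, hi⟩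
    obtain ⟨u, hu, huniq⟩ := (K.existsUnique_cover_iff (p := p)).2 ⟨i, hi⟩
    obtain ⟨a, ha⟩ := hIic u
    refine ⟨⟨p, hp, hp0.symm⟩, a, ⟨u, ha, by rw [hp, hu]⟩, ?_⟩
    rintro b ⟨u', hb, hu'⟩
    rw [hb, ha, huniq u' (by rw [← hu', hp])]

theorem realize_valF (hIic : ∀ w, LowerSet.Iic w ∈ Set.range e) {t s : LHA.Term α} {v : α → A}
    {p w : K n} {i : Fin n} (hp : LowerSet.Iio p = ⊥) (hi : p.val = {i})
    (ht : t.realize (e ∘ v) = LowerSet.Iic p) (hs : s.realize (e ∘ v) = LowerSet.Iic w) :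
    (valF s t).Realize v ↔ i ∈ w.val := by
  rw [← K.mem_val_iff hp hi]
  simp only [valF, Formula.realize_sup, Formula.realize_inf, Formula.realize_not,
    realize_coverF e hIic, realize_leF e, realize_exF, realize_equal_iff e, Sum.comp_elim,
    realize_up, realize_new, realize_supT, Function.comp_apply, ht, hs, LowerSet.Iic_le,
    LowerSet.mem_Iic_iff]
  refine or_congr (and_congr_right fun _ => ⟨?_, ?_⟩) (and_congr_right fun _ => ⟨?_, ?_⟩)
  · rintro ⟨a, b, hab, ⟨u, hu, hu'⟩, ⟨u', hb, hb'⟩⟩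
    exact ⟨u, u', fun h => hab (by rw [hu, hb, h]), hu'.symm, hb'.symm⟩
  · rintro ⟨u, u', hne, hu, hu'⟩
    obtain ⟨a, ha⟩ := hIic u
    obtain ⟨b, hb⟩ := hIic u'
    exact ⟨a, b, fun h => hne (K.Iic_injective (by rw [← ha, ← hb, h])),
      ⟨u, ha, hu.symm⟩, ⟨u', hb, hu'.symm⟩⟩
  · rintro ⟨a, u, hu, hu'⟩
    exact ⟨u, hu'.symm⟩
  · rintro ⟨u, hu⟩
    obtain ⟨a, ha⟩ := hIic u
    exact ⟨a, u, ha, hu.symm⟩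

theorem realize_genF (hIic : ∀ w, LowerSet.Iic w ∈ Set.range e)
    (hIio : ∀ w, LowerSet.Iio w ∈ Set.range e) {t : LHA.Term α} {v : α → A} :
    (genF t).Realize v ↔ ∃ i : Fin n, t.realize (e ∘ v) = varSet i := by
  rw [genF, realize_exF]
  simp only [Formula.realize_inf, realize_unitF e hIic, realize_allF, Formula.realize_imp,
    Formula.realize_iff, realize_exF, realize_coverF e hIic, realize_leF e, Sum.comp_elim,
    realize_up, realize_new, Function.comp_apply]
  have key : ∀ {a : A} {p : K n} {i : Fin n}, e a = LowerSet.Iic p → LowerSet.Iio p = ⊥ →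
      p.val = {i} → ∀ {b : A} {w : K n}, e b = LowerSet.Iic w →
        ((valF new (up new)).Realize (Sum.elim (Sum.elim v fun _ => a) fun _ => b) ↔
          i ∈ w.val) := by
    intro a p i ha hp hi b w hb
    refine realize_valF e hIic hp hi ?_ ?_ <;> simpa [Sum.comp_elim]
  constructor
  · rintro ⟨a, ⟨p, i, ha, hp, hi⟩, h⟩
    refine ⟨i, ?_⟩
    ext w
    obtain ⟨b, hb⟩ := hIic w
    obtain ⟨c, hc⟩ := hIio w
    have := h b ⟨c, w, hb, hc⟩
    rw [key ha hp hi hb, hb, LowerSet.Iic_le] at this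
    exact this
  · rintro ⟨i, hi⟩
    obtain ⟨p, hp, hpv⟩ := K.exists_minimal_val_eq ({i} : Finset (Fin n))
    obtain ⟨a, ha⟩ := hIic p
    refine ⟨a, ⟨p, i, ha, hp, hpv⟩, ?_⟩
    rintro b ⟨c, w, hb, -⟩
    rw [key ha hp hpv hb, hb, LowerSet.Iic_le, hi]
    exact Iff.rfl

/-- In a subalgebra of `FrHat n` that contains the sets generated by a point, and the sets of points
strictly below a point, the solutions of `basisF n` are the enumerations of the generators. -/
theorem realize_basisF (hIic : ∀ w, LowerSet.Iic w ∈ Set.range e)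
    (hIio : ∀ w, LowerSet.Iio w ∈ Set.range e) {x : Fin n → A} :
    (basisF n).Realize x ↔ ∃ σ : Equiv.Perm (Fin n), ∀ i, e (x i) = varSet (σ i) := by
  simp only [basisF, Formula.realize_inf, Formula.realize_iInf, realize_genF e hIic hIio,
    Formula.realize_not, realize_equal_iff e, Term.realize_var, Function.comp_apply]
  constructor
  · rintro ⟨h, hne⟩
    choose σ hσ using h
    have hinj : Function.Injective σ := by
      intro i j hij
      by_contra hne'
      exact hne ⟨(i, j), hne'⟩ (by rw [hσ, hσ, hij])
    exact ⟨Equiv.ofBijective σ (Finite.injective_iff_bijective.1 hinj), hσ⟩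
  · rintro ⟨σ, hσ⟩
    refine ⟨fun i => ⟨σ i, hσ i⟩, fun ij h => ij.2 ?_⟩
    rw [hσ, hσ] at h
    exact σ.injective (varSet_injective h)

end Formulas

/-! ### Embeddings and dense subalgebras -/

section Main

open FirstOrder FirstOrder.Language

/-- The canonical homomorphism, as an embedding of first-order structures. -/
noncomputable def toHatEmbedding (n : ℕ) : Fr n ↪[LHA] FrHat n where
  toFun := toHat n
  inj' := toHat_injective n
  map_fun' f x := by
    cases f with
    | zero => exact map_bot (toHat n)
    | one => exact map_top (toHat n)
    | inf => exact map_inf (toHat n) _ _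
    | sup => exact map_sup (toHat n) _ _
    | imp => exact map_himp (toHat n) _ _
  map_rel' r _ := nomatch r

/-- A Heyting term as a term of the first-order language. -/
def HTerm.toTerm {α : Type*} : HTerm α → LHA.Term α
  | .var i => Term.var i
  | .bot => Constants.term (HAFunc.zero : LHA.Functions 0)
  | .top => Constants.term (HAFunc.one : LHA.Functions 0)
  | .inf a b => Functions.apply₂ (L := LHA) HAFunc.inf a.toTerm b.toTerm
  | .sup a b => Functions.apply₂ (L := LHA) HAFunc.sup a.toTerm b.toTerm
  | .imp a b => Functions.apply₂ (L := LHA) HAFunc.imp a.toTerm b.toTerm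

theorem HTerm.realize_toTerm {α H : Type*} [HeytingAlgebra H] (x : α → H) (t : HTerm α) :
    t.toTerm.realize x = FreeHeyting.value x t := by
  induction t with
  | var i => rfl
  | bot => exact Term.realize_constants
  | top => exact Term.realize_constants
  | inf a b iha ihb => exact Term.realize_functions_apply₂.trans (congrArg₂ (· ⊓ ·) iha ihb)
  | sup a b iha ihb => exact Term.realize_functions_apply₂.trans (congrArg₂ (· ⊔ ·) iha ihb)
  | imp a b iha ihb => exact Term.realize_functions_apply₂.trans (congrArg₂ (· ⇨ ·) iha ihb)

/-- The generators, in any order, satisfy only the identities that hold in the free algebra. -/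
theorem value_gen_comp_perm_eq_iff {α : Type*} (σ : Equiv.Perm α) (s t : HTerm α) :
    FreeHeyting.value (FreeHeyting.gen ∘ σ) s = FreeHeyting.value (FreeHeyting.gen ∘ σ) t ↔
      FreeHeyting.mk s = FreeHeyting.mk t := by
  set φ := FreeHeyting.lift (FreeHeyting.gen ∘ σ)
  set ψ := FreeHeyting.lift (FreeHeyting.gen ∘ σ.symm)
  have hψφ : ∀ x, ψ (φ x) = x := by
    have : ψ.comp φ = HeytingHom.id _ := by
      apply FreeHeyting.hom_ext
      intro i
      change FreeHeyting.gen (σ.symm (σ i)) = FreeHeyting.gen i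
      rw [Equiv.symm_apply_apply]
    exact fun x => DFunLike.congr_fun this x
  exact ⟨fun h => (hψφ (FreeHeyting.mk s)).symm.trans
    ((congrArg ψ h).trans (hψφ (FreeHeyting.mk t))), fun h => congrArg φ h⟩

/-- A tuple of a first-order structure that satisfies exactly the identities between terms that
hold in the free algebra gives rise to an embedding of the free algebra. -/
theorem nonempty_embedding_of_realize_eq_iff {α M : Type*} [LHA.Structure M] (m : α → M)
    (h : ∀ s t : HTerm α, s.toTerm.realize m = t.toTerm.realize m ↔
      FreeHeyting.mk s = FreeHeyting.mk t) : Nonempty (FreeHeyting α ↪[LHA] M) := by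
  let f : FreeHeyting α → M := Quotient.lift (fun t : HTerm α => t.toTerm.realize m)
    fun s t hst => (h s t).2 (Quotient.sound hst)
  refine ⟨⟨⟨f, ?_⟩, ?_, fun r _ => nomatch r⟩⟩
  · rintro ⟨s⟩ ⟨t⟩ hst
    exact (h s t).1 hst
  · intro k c x
    have hx : ∀ x : Fin 2 → FreeHeyting α, ∃ s t : HTerm α, x 0 = FreeHeyting.mk s ∧
        x 1 = FreeHeyting.mk t ∧ f ∘ x = ![s.toTerm.realize m, t.toTerm.realize m] := by
      intro x
      obtain ⟨s, hs⟩ := Quotient.exists_rep (x 0)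
      obtain ⟨t, ht⟩ := Quotient.exists_rep (x 1)
      refine ⟨s, t, hs.symm, ht.symm, funext fun j => ?_⟩
      fin_cases j
      · exact congrArg f hs.symm
      · exact congrArg f ht.symm
    change f _ = Structure.funMap _ (f ∘ x)
    cases c with
    | zero =>
      exact Term.realize_constants.trans
        (congrArg (Structure.funMap (L := LHA) HAFunc.zero) (Subsingleton.elim _ _))
    | one =>
      exact Term.realize_constants.trans
        (congrArg (Structure.funMap (L := LHA) HAFunc.one) (Subsingleton.elim _ _))
    | inf =>
      obtain ⟨s, t, hs, ht, hst⟩ := hx x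
      change f (x 0 ⊓ x 1) = _
      rw [hst, hs, ht]
      exact Term.realize_functions_apply₂
    | sup =>
      obtain ⟨s, t, hs, ht, hst⟩ := hx x
      change f (x 0 ⊔ x 1) = _
      rw [hst, hs, ht]
      exact Term.realize_functions_apply₂
    | imp =>
      obtain ⟨s, t, hs, ht, hst⟩ := hx x
      change f (x 0 ⇨ x 1) = _
      rw [hst, hs, ht]
      exact Term.realize_functions_apply₂

theorem eq_top_of_gen_mem {α : Type*} {H : LHA.Substructure (FreeHeyting α)}
    (h : ∀ i, FreeHeyting.gen i ∈ H) : H = ⊤ := by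
  have hpair : ∀ x y : FreeHeyting α, x ∈ H → y ∈ H → ∀ j, ![x, y] j ∈ (H : Set _) := by
    intro x y hx hy j
    fin_cases j
    · exact hx
    · exact hy
  rw [eq_top_iff]
  rintro ⟨t⟩ -
  change FreeHeyting.mk t ∈ H
  induction t with
  | var i => exact h i
  | bot => exact H.fun_mem (HAFunc.zero : LHA.Functions 0) ![] nofun
  | top => exact H.fun_mem (HAFunc.one : LHA.Functions 0) ![] nofun
  | inf a b iha ihb => exact H.fun_mem (HAFunc.inf : LHA.Functions 2) _ (hpair _ _ iha ihb)
  | sup a b iha ihb => exact H.fun_mem (HAFunc.sup : LHA.Functions 2) _ (hpair _ _ iha ihb)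
  | imp a b iha ihb => exact H.fun_mem (HAFunc.imp : LHA.Functions 2) _ (hpair _ _ iha ihb)

/-- Any enumeration of the generators is a solution of `basisF n` in the free algebra, and there are
no others. -/
theorem realize_basisF_free {n : ℕ} {x : Fin n → Fr n} :
    (basisF n).Realize x ↔ ∃ σ : Equiv.Perm (Fin n), x = FreeHeyting.gen ∘ σ := by
  rw [realize_basisF (toHatEmbedding n) Iic_mem_range Iio_mem_range]
  refine exists_congr fun σ => ⟨fun h => funext fun i => toHat_injective n (h i), ?_⟩
  rintro rfl i
  rfl

/-- The sentence `∃ x₁ … xₙ, φ`. -/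
noncomputable def exSentence {n : ℕ} (φ : LHA.Formula (Fin n)) : LHA.Sentence :=
  (Formula.relabel (Sum.inr : Fin n → Empty ⊕ Fin n) φ).iExs (Fin n)

/-- The sentence `∀ x₁ … xₙ, φ`. -/
noncomputable def allSentence {n : ℕ} (φ : LHA.Formula (Fin n)) : LHA.Sentence :=
  (Formula.relabel (Sum.inr : Fin n → Empty ⊕ Fin n) φ).iAlls (Fin n)

theorem realize_exSentence {n : ℕ} {φ : LHA.Formula (Fin n)} {M : Type*} [LHA.Structure M] :
    M ⊨ exSentence φ ↔ ∃ x : Fin n → M, φ.Realize x := by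
  rw [Sentence.Realize, exSentence, Formula.realize_iExs]
  simp only [Formula.realize_relabel, Sum.elim_comp_inr]

theorem realize_allSentence {n : ℕ} {φ : LHA.Formula (Fin n)} {M : Type*} [LHA.Structure M] :
    M ⊨ allSentence φ ↔ ∀ x : Fin n → M, φ.Realize x := by
  rw [Sentence.Realize, allSentence, Formula.realize_iAlls]
  simp only [Formula.realize_relabel, Sum.elim_comp_inr]

theorem exists_realize_basisF (n : ℕ) : Fr n ⊨ exSentence (basisF n) :=
  realize_exSentence.2 ⟨FreeHeyting.gen, realize_basisF_free.2 ⟨1, rfl⟩⟩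

/-- A dense set contains every element whose image lies in a stage of the generic Kripke model, as
such elements are isolated. -/
theorem mem_of_dense {n : ℕ} {S : Set (Fr n)} (hS : Dense S) {x : Fr n} {i : ℕ}
    (hx : ∀ w ∈ toHat n x, w.1 ∈ stage n i) : x ∈ S := by
  obtain ⟨y, hy, hxy⟩ := hS.exists_dist_lt x (show (0 : ℝ) < 2⁻¹ ^ (i + 1) by positivity)
  have hd : hatDist (toHat n x) (toHat n y) < 2⁻¹ ^ (i + 1) := hxy
  have hcut : cut i (toHat n x) = cut i (toHat n y) :=
    (hatDist_le_iff _ _ _ (hatDist_nonneg _ _)).1 le_rfl i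
      (hd.trans_le (pow_le_pow_of_le_one (by norm_num) (by norm_num) (by omega)))
  rw [toHat_injective n (eq_of_cut_eq hx hcut.symm)] at hy
  exact hy

end Main

end FreeHA

theorem mainTheorem6 (n : ℕ) (hn : 0 < n) :
    (∀ (M : Type*) [FreeHA.LHA.Structure M],
      M ⊨ FreeHA.LHA.completeTheory (FreeHA.Fr n) →
        Nonempty (FreeHA.Fr n ↪[FreeHA.LHA] M)) ∧
    (∀ H : FreeHA.LHA.Substructure (FreeHA.Fr n),
      Dense (H : Set (FreeHA.Fr n)) → H ≠ ⊤ →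
        ¬ FreeHA.LHA.ElementarilyEquivalent H (FreeHA.Fr n)) := by
  open FreeHA FirstOrder.Language in
  refine ⟨fun M _ hM => ?_, fun H hdense hH hequiv => hH ?_⟩
  · -- A tuple of `M` satisfying the formula of the generators satisfies the same identities.
    have htrue : ∀ φ : LHA.Sentence, Fr n ⊨ φ → M ⊨ φ := fun φ hφ =>
      (LHA.completeTheory (Fr n)).realize_sentence_of_mem hφ
    obtain ⟨m, hm⟩ := realize_exSentence.1 (htrue _ (exists_realize_basisF n))
    refine nonempty_embedding_of_realize_eq_iff m fun s t => ?_
    have key : ∀ x : Fin n → Fr n, (basisF n).Realize x →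
        ((s.toTerm.equal t.toTerm).Realize x ↔ FreeHeyting.mk s = FreeHeyting.mk t) := by
      intro x hx
      obtain ⟨σ, rfl⟩ := realize_basisF_free.1 hx
      rw [Formula.realize_equal, HTerm.realize_toTerm, HTerm.realize_toTerm,
        value_gen_comp_perm_eq_iff]
    rw [← Formula.realize_equal]
    by_cases hst : FreeHeyting.mk s = FreeHeyting.mk t
    · have := htrue (allSentence ((basisF n).imp (s.toTerm.equal t.toTerm)))
        (realize_allSentence.2 fun x => Formula.realize_imp.2 fun hx => (key x hx).2 hst)
      exact iff_of_true (Formula.realize_imp.1 (realize_allSentence.1 this m) hm) hst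
    · have := htrue (allSentence ((basisF n).imp (s.toTerm.equal t.toTerm).not))
        (realize_allSentence.2 fun x => Formula.realize_imp.2 fun hx =>
          Formula.realize_not.2 fun h => hst ((key x hx).1 h))
      exact iff_of_false
        (Formula.realize_not.1 (Formula.realize_imp.1 (realize_allSentence.1 this m) hm)) hst
  · -- `H` contains the finite decreasing sets, so that the formula defines generators in `H` too.
    have hmem : ∀ a : FrHat n, a ∈ Set.range (toHat n) → ∀ i, (∀ w ∈ a, w.1 ∈ stage n i) →
        a ∈ Set.range ((toHatEmbedding n).comp H.subtype) := by
      rintro _ ⟨x, rfl⟩ i hx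
      exact ⟨⟨x, mem_of_dense hdense hx⟩, rfl⟩
    have hbelow : ∀ w : K n, ∃ i, ∀ u ≤ w, u.1 ∈ stage n i := by
      intro w
      obtain ⟨i, hi⟩ := w.2
      refine ⟨i, fun u hu => ?_⟩
      rcases K.le_def.1 hu with h | h
      · exact mem_stage_of_below hi h
      · exact h ▸ hi
    obtain ⟨x, hx⟩ := realize_exSentence.1
      ((hequiv.realize_sentence _).2 (exists_realize_basisF n))
    obtain ⟨σ, hσ⟩ := (realize_basisF ((toHatEmbedding n).comp H.subtype)
      (fun w => (hbelow w).elim fun i hi => hmem _ (Iic_mem_range w) i hi)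
      (fun w => (hbelow w).elim fun i hi => hmem _ (Iio_mem_range w) i
        fun u hu => hi u (le_of_lt hu))).1 hx
    have hgen : ∀ i, FreeHeyting.gen i ∈ H := by
      intro i
      have : (x (σ.symm i) : Fr n) = FreeHeyting.gen i := toHat_injective n (by
        have := hσ (σ.symm i)
        rw [Equiv.apply_symm_apply] at this
        exact this)
      exact this ▸ (x (σ.symm i)).2
    exact eq_top_of_gen_mem hgen
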